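/- **Definitions.** A topological dynamical system $(X,T)$ is a compact metrizable space $X$ with a continuous self-map $T:X\to X$; $\mathscr D(X)$ is the set of metrics on $X$ compatible with its topology. For $f\in C(X,\mathbb R)$ and $d\in\mathscr D(X)$ put $S_nf(x)=\sum_{j=0}^{n-1}f(T^jx)$ and $d_n(x,y)=\max_{0\le j\le n-1}d(T^jx,T^jy)$. For $\epsilon>0$ let $$R_n(X,f,d,\epsilon)=\inf\Big\{\sum_{i=1}^{m}(1/\epsilon)^{\sup_{U_i}S_nf}\;:\;X=U_1\cup\dots\cup U_m \text{ is an open cover with } \operatorname{diam}(U_i,d_n)<\epsilon \text{ for all } i\Big\},$$ $R(X,f,d,\epsilon)=\lim_{n\to\infty}\frac1n\log R_n(X,f,d,\epsilon)$ (the limit exists for $0<\epsilon<1$), and $$\overline{\mathrm{mdim}}_M(T,X,f,d)=\limsup_{\epsilon\to0}\frac{R(X,f,d,\epsilon)}{\log(1/\epsilon)},\qquad \underline{\mathrm{mdim}}_M(T,X,f,d)=\liminf_{\epsilon\to0}\frac{R(X,f,d,\epsilon)}{\log(1/\epsilon)},$$ with values in the extended reals. If the two agree, the common value is denoted $\mathrm{mdim}_M(T,X,f,d)$.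 For a finite simplicial complex $P$ and $a\in P$ let $\dim_aP$ be the maximal dimension of the simplices of $P$ containing $a$. Let $\mathrm{Widim}_\epsilon(X,d_n,S_nf)$ be the infimum of $\max_{x\in X}\big(\dim_{g(x)}P+S_nf(x)\big)$ over all finite simplicial complexes $P$ and all continuous $g:X\to P$ with $\operatorname{diam}(g^{-1}(y),d_n)<\epsilon$ for every $y\in P$. The mean dimension with potential is $$\mathrm{mdim}(T,X,f)=\lim_{\epsilon\to0}\lim_{n\to\infty}\frac{\mathrm{Widim}_\epsilon(X,d_n,S_nf)}n,$$ which does not depend on $d\in\mathscr D(X)$. Write $\mathscr D'(X)=\{d\in\mathscr D(X):\mathrm{mdim}(T,X,f)=\overline{\mathrm{mdim}}_M(T,X,f,d)\}$. The system $(X,T)$ has the marker property if for every integer $N>0$ there is an open set $U\subset X$ with $U\cap T^nU=\emptyset$ for $1\le n\le N$ and $X=\bigcup_{n\in\mathbb Z}T^nU$ (for $n<0$, $T^{n}U$ is the preimage of $U$ under $T^{-n}$). **Proposition 2.4 (product formula).** For $i=1,2$ let $(X_i,T_i)$ be a topological dynamical system with $d_i\in\mathscr D(X_i)$ and $f_i\in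 C(X_i,\mathbb R)$. On $X_1\times X_2$ consider $T_1\times T_2:(x_1,x_2)\mapsto(T_1x_1,T_2x_2)$, the metric $d((x_1,x_2),(y_1,y_2))=\max\{d_1(x_1,y_1),d_2(x_2,y_2)\}$ and the potential $f(x_1,x_2)=f_1(x_1)+f_2(x_2)$. Then $$\overline{\mathrm{mdim}}_M(T_1\times T_2,X_1\times X_2,f,d)\le\overline{\mathrm{mdim}}_M(T_1,X_1,f_1,d_1)+\overline{\mathrm{mdim}}_M(T_2,X_2,f_2,d_2),$$ $$\underline{\mathrm{mdim}}_M(T_1\times T_2,X_1\times X_2,f,d)\ge\underline{\mathrm{mdim}}_M(T_1,X_1,f_1,d_1)+\underline{\mathrm{mdim}}_M(T_2,X_2,f_2,d_2).$$ Moreover, if both $(X_i,T_i)$ have the marker property and $d_i\in\mathscr D'(X_i)$ (with respect to $f_i$) for $i=1,2$, then the upper and lower metric mean dimensions with potential agree for $(X_1,T_1,f_1,d_1)$, for $(X_2,T_2,f_2,d_2)$ and for the product, and $$\mathrm{mdim}_M(T_1\times T_2,X_1\times X_2,f,d)=\mathrm{mdim}_M(T_1,X_1,f_1,d_1)+\mathrm{mdim}_M(T_2,X_2,f_2,d_2).$$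 -/

import Mathlib

open Set Filter Topology

noncomputable section

namespace MeanDimPotential

/-- The orbit map `x ↦ (x, T x, …, T^(n-1) x)` into `X^n`. For the max metric on `X^n` (Mathlib's
metric on `Fin n → X`), the Bowen metric is
`d_n x y = max_{0 ≤ j < n} d (T^j x) (T^j y) = dist (orbitMap T n x) (orbitMap T n y)`. -/
def orbitMap {X : Type*} (T : X → X) (n : ℕ) (x : X) : Fin n → X :=
  fun j => T^[j] x

/-- The diameter of `U` for the Bowen metric `d_n`. -/
def bowenDiam {X : Type*} [MetricSpace X] (T : X → X) (n : ℕ) (U : Set X) : ℝ :=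
  Metric.diam (orbitMap T n '' U)

/-- `R_n(X, f, d, ε)`: the infimum, over all finite open covers `(U_i)` of `X` whose members have
`d_n`-diameter less than `ε`, of `∑ i, (1/ε) ^ (sup_{U_i} S_n f)`. Here `S_n f` is
`birkhoffSum T f n`. An empty member contributes at least as much as leaving it out, so that
empty members do not affect the infimum. -/
def coverSum {X : Type*} [MetricSpace X] (T : X → X) (f : X → ℝ) (n : ℕ) (ε : ℝ) : ENNReal :=
  ⨅ (m : ℕ) (U : Fin m → Set X) (_ : ∀ i, IsOpen (U i)) (_ : (⋃ i, U i) = univ)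
    (_ : ∀ i, bowenDiam T n (U i) < ε),
    ∑ i, ENNReal.ofReal ((1 / ε) ^ (⨆ x : U i, birkhoffSum T f n x))

/-- `R(X, f, d, ε) = lim_{n → ∞} log R_n(X, f, d, ε) / n`. For a compact system and `0 < ε < 1` the
sequence `log R_n` is subadditive, so that the limit exists and is the `limsup`. -/
def coverRate {X : Type*} [MetricSpace X] (T : X → X) (f : X → ℝ) (ε : ℝ) : EReal :=
  limsup (fun n : ℕ => ENNReal.log (coverSum T f n ε) / (n : EReal)) atTop

/-- Upper metric mean dimension with potential `f`, for the metric of `X`. -/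
def upperMetricMeanDim {X : Type*} [MetricSpace X] (T : X → X) (f : X → ℝ) : EReal :=
  limsup (fun ε : ℝ => coverRate T f ε / (Real.log (1 / ε) : EReal)) (𝓝[>] 0)

/-- Lower metric mean dimension with potential `f`, for the metric of `X`. -/
def lowerMetricMeanDim {X : Type*} [MetricSpace X] (T : X → X) (f : X → ℝ) : EReal :=
  liminf (fun ε : ℝ => coverRate T f ε / (Real.log (1 / ε) : EReal)) (𝓝[>] 0)

/-- The local dimension of a simplicial complex `P` at a point `a` of its underlying space: the
maximal dimension of the simplices of `P` that contain `a`. -/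
def localDim {m : ℕ} (P : Geometry.SimplicialComplex ℝ (Fin m → ℝ)) (a : Fin m → ℝ) : EReal :=
  ⨆ (s : Finset (Fin m → ℝ)) (_ : s ∈ P.faces) (_ : a ∈ convexHull ℝ (s : Set (Fin m → ℝ))),
    ((s.card - 1 : ℕ) : EReal)

/-- The `ε`-width dimension with potential `Widim_ε(X, d_n, S_n f)`: the infimum of
`max_x (dim_{g(x)} P + S_n f(x))` over all finite simplicial complexes `P` and all `ε`-embeddings
`g : X → P` for `d_n`, i.e. continuous maps all of whose fibres have `d_n`-diameter less than `ε`.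
Every finite simplicial complex is realised in some `ℝ^m`. -/
def widim {X : Type*} [MetricSpace X] (T : X → X) (f : X → ℝ) (n : ℕ) (ε : ℝ) : EReal :=
  ⨅ (m : ℕ) (P : Geometry.SimplicialComplex ℝ (Fin m → ℝ)) (_ : P.faces.Finite)
    (g : C(X, P.space)) (_ : ∀ y : P.space, bowenDiam T n (g ⁻¹' {y}) < ε),
    ⨆ x : X, (localDim P (g x) + ((birkhoffSum T f n x : ℝ) : EReal))

/-- Mean dimension with potential,
`mdim(T, X, f) = lim_{ε → 0} lim_{n → ∞} Widim_ε(X, d_n, S_n f) / n`. For a compact system both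
limits exist, since `Widim` is subadditive in `n` and monotone in `ε`, so that they are the
`limsup`s; the value does not depend on the metric within the topology. -/
def meanDim {X : Type*} [MetricSpace X] (T : X → X) (f : X → ℝ) : EReal :=
  limsup (fun ε : ℝ => limsup (fun n : ℕ => widim T f n ε / (n : EReal)) atTop) (𝓝[>] 0)

/-- The marker property: for every `N > 0` there is an open set `U` with `U ∩ T^n U = ∅` for
`1 ≤ n ≤ N` and `X = ⋃_{n ∈ ℤ} T^n U`. For `n ≥ 0` the set `T^n U` is the image and `T^(-n) U` is
the preimage of `U` under the `n`-th iterate, so that `T` need not be invertible. -/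
def HasMarkerProperty {X : Type*} [TopologicalSpace X] (T : X → X) : Prop :=
  ∀ N : ℕ, 0 < N → ∃ U : Set X, IsOpen U ∧
    (∀ n : ℕ, 1 ≤ n → n ≤ N → U ∩ T^[n] '' U = ∅) ∧
    (⋃ n : ℕ, T^[n] '' U) ∪ (⋃ n : ℕ, T^[n] ⁻¹' U) = univ

end MeanDimPotential

end

/-!
A weighted open cover carries a bound for the Birkhoff sum on each member, and `coverSum` is the
infimum of `∑ i, (1 / ε) ^ s i` over such covers. Refining a cover by a preimage of another makes
`n ↦ log R_n` subadditive, so that `coverRate` is a limit by Fekete's lemma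
(`exists_tendsto_logCoverSum`). This limit is finite for nonempty systems and `⊥` for empty ones.

*Upper bound.* Products of weighted covers are weighted covers of the product, whence
`log R_n` of the product is at most the sum of the two (`logCoverSum_prodMap_le`).

*Lower bound.* If `E` is maximal among the `ε`-separated sets of the Bowen metric, then
`∑ e ∈ E, (1 / ε) ^ S_n f e` is at most `R_n(ε)`, because a member of a cover of mesh `ε` contains
at most one point of `E`, and it is at least `R_n(3 ε)` up to a factor `exp (n * o (log (1 / ε)))`,
because the Bowen balls around `E` form a cover. Products of separated sets are separated for the
max metric, so that the growth rates at scale `3 ε` add up to at most the one of the product at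
scale `ε`, up to `o (log (1 / ε))` (`logCoverSum_add_le`).

*Equality.* Mean dimension never exceeds the lower metric mean dimension
(`meanDim_le_lowerMetricMeanDim`). Hence equality of mean dimension and upper metric mean dimension
forces the upper and lower values of each factor to agree, and then the two inequalities collapse.
To bound the width dimension at a scale `ε`, map `X` to the nerve of an open cover of small mesh;
what counts is the order of the cover at `x`, plus `S_n f x` (`widim_le_of_openCover`). The cover is
built from the functions `x ↦ d (T^j x) e`, `j < n`, `e` in a net, each compared with a threshold
`ξ`: its order at `x` is at most one more than the number of functions within `δ` of their threshold
at `x` (`ncard_setOf_mem_thresholdSet_le`). For thresholds drawn from a grid of spacing `4 δ` the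
average of `(1 / δ) ^ (number of near thresholds)` is at most a constant to the power `n` that does
not depend on `δ`. Averaging this against the weights of a nearly optimal cover of mesh `δ` gives
thresholds for which the order, less one, plus `S_n f` is at most
`log R_n(δ) / log (1 / δ) + n * O (1 / log (1 / δ))` everywhere (`widim_le_logCoverSum`). Then
`δ → 0`, and finally `ε → 0`.
-/

noncomputable section

namespace MeanDimPotential

/-! ### The Bowen metric and weighted covers -/

lemma abs_birkhoffSum_le {X : Type*} {T : X → X} {f : X → ℝ} {F : ℝ} (hF : ∀ x, |f x| ≤ F)
    (n : ℕ) (x : X) :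
    |birkhoffSum T f n x| ≤ n * F := by
  refine (Finset.abs_sum_le_sum_abs _ _).trans ?_
  simpa using Finset.sum_le_card_nsmul (Finset.range n) _ F fun j _ => hF (T^[j] x)

section Covers

variable {X : Type*} [MetricSpace X] {T : X → X} {f : X → ℝ}

lemma dist_iterate_le_bowenDiam [CompactSpace X] {n j : ℕ} {U : Set X} {x y : X}
    (hx : x ∈ U) (hy : y ∈ U) (hj : j < n) : dist (T^[j] x) (T^[j] y) ≤ bowenDiam T n U :=
  (dist_le_pi_dist (orbitMap T n x) (orbitMap T n y) ⟨j, hj⟩).trans <|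
    Metric.dist_le_diam_of_mem (Metric.isBounded_of_compactSpace) (mem_image_of_mem _ hx)
      (mem_image_of_mem _ hy)

lemma bowenDiam_lt {n : ℕ} {U : Set X} {ε ρ : ℝ} (hε : 0 < ε) (hρ : ρ < ε)
    (h : ∀ x ∈ U, ∀ y ∈ U, ∀ j < n, dist (T^[j] x) (T^[j] y) ≤ ρ) : bowenDiam T n U < ε := by
  refine lt_of_le_of_lt (b := max ρ 0) ?_ (max_lt hρ hε)
  refine Metric.diam_le_of_forall_dist_le (le_max_right _ _) ?_
  rintro _ ⟨x, hx, rfl⟩ _ ⟨y, hy, rfl⟩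
  exact (dist_pi_le_iff (le_max_right _ _)).2
    fun j => (h x hx y hy j j.2).trans (le_max_left _ _)

lemma continuous_orbitMap (hT : Continuous T) (n : ℕ) : Continuous (orbitMap T n) :=
  continuous_pi fun j => hT.iterate j

lemma continuous_birkhoffSum (hT : Continuous T) (hf : Continuous f) (n : ℕ) :
    Continuous (birkhoffSum T f n) :=
  continuous_finsetSum _ fun j _ => hf.comp (hT.iterate j)

lemma birkhoffSum_le_add_of_dist_lt {n : ℕ} {δ ω : ℝ}
    (hω : ∀ u v, dist u v < δ → |f u - f v| ≤ ω) {x y : X}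
    (h : ∀ j < n, dist (T^[j] x) (T^[j] y) < δ) :
    birkhoffSum T f n x ≤ birkhoffSum T f n y + n * ω := by
  have h' : ∑ j ∈ Finset.range n, (f (T^[j] x) - f (T^[j] y)) ≤ n * ω := by
    simpa using Finset.sum_le_card_nsmul (Finset.range n) _ ω fun j hj =>
      (le_abs_self _).trans (hω _ _ (h j (Finset.mem_range.1 hj)))
  rw [Finset.sum_sub_distrib] at h'
  unfold birkhoffSum
  linarith

lemma exists_abs_le [CompactSpace X] (hf : Continuous f) : ∃ F, 0 ≤ F ∧ ∀ x, |f x| ≤ F := by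
  obtain ⟨F, hF⟩ := isCompact_univ.exists_bound_of_continuousOn hf.continuousOn
  exact ⟨max F 0, le_max_right _ _, fun x => (hF x (mem_univ x)).trans (le_max_left _ _)⟩

/-- An open cover `U` with Bowen diameters less than `ε`, together with upper bounds `s i` for the
Birkhoff sum of `f` on `U i`. The bound of an empty member is unconstrained, in contrast to the
real supremum, which is `0` there. -/
structure IsWeightedCover (T : X → X) (f : X → ℝ) (n : ℕ) (ε : ℝ) {ι : Type*}
    (U : ι → Set X) (s : ι → ℝ) : Prop where
  isOpen : ∀ i, IsOpen (U i)
  exists_mem : ∀ x, ∃ i, x ∈ U i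
  diam_lt : ∀ i, bowenDiam T n (U i) < ε
  sum_le : ∀ i, ∀ x ∈ U i, birkhoffSum T f n x ≤ s i

lemma IsWeightedCover.coverSum_le {n : ℕ} {ε : ℝ} (hε : 0 < ε) (hε1 : ε ≤ 1) {ι : Type*}
    [Fintype ι] {U : ι → Set X} {s : ι → ℝ} (h : IsWeightedCover T f n ε U s) :
    coverSum T f n ε ≤ ENNReal.ofReal (∑ i, (1 / ε) ^ s i) := by
  classical
  have h1 : 1 ≤ 1 / ε := by rwa [le_div_iff₀ hε, one_mul]
  have hpos : ∀ i, 0 ≤ (1 / ε) ^ s i := fun i => by positivity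
  -- Empty members are dropped first.
  let e := (Fintype.equivFin {i // (U i).Nonempty}).symm
  have hcov : (⋃ k, U (e k)) = univ := by
    refine eq_univ_of_forall fun x => ?_
    obtain ⟨i, hi⟩ := h.exists_mem x
    exact mem_iUnion.2 ⟨e.symm ⟨i, x, hi⟩, by simpa using hi⟩
  unfold coverSum
  refine iInf_le_of_le (Fintype.card {i // (U i).Nonempty}) ?_
  refine iInf_le_of_le (fun k => U (e k)) ?_
  refine iInf_le_of_le (fun k => h.isOpen _) ?_
  refine iInf_le_of_le hcov ?_
  refine iInf_le_of_le (fun k => h.diam_lt _) ?_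
  calc ∑ k, ENNReal.ofReal ((1 / ε) ^ (⨆ x : U (e k), birkhoffSum T f n x))
      ≤ ∑ k, ENNReal.ofReal ((1 / ε) ^ s (e k)) := by
        refine Finset.sum_le_sum fun k _ => ENNReal.ofReal_le_ofReal ?_
        have : Nonempty (U (e k)) := (e k).2.to_subtype
        exact Real.rpow_le_rpow_of_exponent_le h1 (ciSup_le fun x => h.sum_le _ x x.2)
    _ = ∑ i : {i // (U i).Nonempty}, ENNReal.ofReal ((1 / ε) ^ s i) :=
        e.sum_comp fun i => ENNReal.ofReal ((1 / ε) ^ s i)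
    _ ≤ ∑ i, ENNReal.ofReal ((1 / ε) ^ s i) :=
        (Finset.sum_subtype (Finset.univ.filter fun i => (U i).Nonempty) (by simp)
          fun i => ENNReal.ofReal ((1 / ε) ^ s i)).symm.le.trans
          (Finset.sum_le_sum_of_subset (Finset.filter_subset _ _))
    _ = _ := (ENNReal.ofReal_sum_of_nonneg fun i _ => hpos i).symm

lemma exists_isWeightedCover_of_coverSum_lt [CompactSpace X] (hT : Continuous T)
    (hf : Continuous f) {n : ℕ} {ε v : ℝ} (hε : 0 < ε)
    (h : coverSum T f n ε < ENNReal.ofReal v) :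
    ∃ (m : ℕ) (U : Fin m → Set X) (s : Fin m → ℝ),
      IsWeightedCover T f n ε U s ∧ ∑ i, (1 / ε) ^ s i < v := by
  simp only [coverSum, iInf_lt_iff] at h
  obtain ⟨m, U, hUo, hUc, hUd, hlt⟩ := h
  refine ⟨m, U, fun i => ⨆ x : U i, birkhoffSum T f n x,
    ⟨hUo, fun x => mem_iUnion.1 (hUc ▸ mem_univ x), hUd, fun i x hx => ?_⟩, ?_⟩
  · have hb : BddAbove (range fun x : U i => birkhoffSum T f n x) :=
      (isCompact_range (continuous_birkhoffSum hT hf n)).bddAbove.mono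
        (range_subset_iff.2 fun x => mem_range_self _)
    exact le_ciSup hb ⟨x, hx⟩
  · rw [← ENNReal.ofReal_sum_of_nonneg fun i _ => by positivity] at hlt
    exact (ENNReal.ofReal_lt_ofReal_iff_of_nonneg (by positivity)).1 hlt

/-- A maximal separated set for the pseudometric pulled back along a continuous map. -/
lemma exists_finset_separated [CompactSpace X] {Y : Type*} [PseudoMetricSpace Y] {φ : X → Y}
    (hφ : Continuous φ) {ε : ℝ} (hε : 0 < ε) :
    ∃ E : Finset X, (∀ x ∈ E, ∀ y ∈ E, x ≠ y → ε ≤ dist (φ x) (φ y)) ∧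
      ∀ x, ∃ e ∈ E, dist (φ x) (φ e) < ε := by
  classical
  let S : Set ℕ := {k | ∃ E : Finset X,
    (∀ x ∈ E, ∀ y ∈ E, x ≠ y → ε ≤ dist (φ x) (φ y)) ∧ E.card = k}
  obtain ⟨t, ht⟩ := isCompact_univ.elim_finite_subcover
    (fun x : X => φ ⁻¹' Metric.ball (φ x) (ε / 2)) (fun x => Metric.isOpen_ball.preimage hφ)
    (fun x _ => mem_iUnion.2 ⟨x, Metric.mem_ball_self (half_pos hε)⟩)
  have hbdd : BddAbove S := by
    refine ⟨t.card, ?_⟩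
    rintro _ ⟨E, hE, rfl⟩
    have hch : ∀ x : X, ∃ c ∈ t, dist (φ x) (φ c) < ε / 2 := fun x => by
      simpa using ht (mem_univ x)
    choose c hct hc using hch
    refine Finset.card_le_card_of_injOn c (fun x _ => hct x) fun x hx y hy hxy => ?_
    by_contra hne
    have h1 := hE x hx y hy hne
    have h2 := hc y
    rw [← hxy] at h2
    linarith [hc x, dist_triangle_right (φ x) (φ y) (φ (c x))]
  obtain ⟨E, hE, hcard⟩ : sSup S ∈ S := Nat.sSup_mem ⟨0, ∅, by simp, rfl⟩ hbdd
  refine ⟨E, hE, fun x => ?_⟩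
  by_contra! hx
  have hxE : x ∉ E := fun h => by simpa using (hε.trans_le (hx x h))
  have : (insert x E).card ∈ S := by
    refine ⟨insert x E, ?_, rfl⟩
    intro a ha b hb hab
    rcases Finset.mem_insert.1 ha with rfl | ha' <;> rcases Finset.mem_insert.1 hb with rfl | hb'
    · exact absurd rfl hab
    · exact hx b hb'
    · rw [dist_comm]; exact hx a ha'
    · exact hE a ha' b hb' hab
  have := le_csSup hbdd this
  rw [Finset.card_insert_of_notMem hxE] at this
  omega

/-- Bowen balls of radius `ε` around a set that is `ε`-dense for the Bowen metric. -/
lemma isWeightedCover_balls (hT : Continuous T) {n : ℕ} {ε ε' ω : ℝ} (hε : 0 < ε)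
    (hε' : 2 * ε < ε') (hω : ∀ u v, dist u v < ε → |f u - f v| ≤ ω) {E : Finset X}
    (hE : ∀ x, ∃ e ∈ E, dist (orbitMap T n x) (orbitMap T n e) < ε) :
    IsWeightedCover T f n ε' (fun e : E => {x | dist (orbitMap T n x) (orbitMap T n e) < ε})
      (fun e => birkhoffSum T f n e + n * ω) where
  isOpen e := isOpen_lt ((continuous_orbitMap hT n).dist continuous_const) continuous_const
  exists_mem x := by
    obtain ⟨e, he, h⟩ := hE x
    exact ⟨⟨e, he⟩, h⟩
  diam_lt e := by
    refine bowenDiam_lt (by linarith) hε' fun x hx y hy j hj => ?_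
    have h1 := (dist_le_pi_dist (orbitMap T n x) (orbitMap T n e) ⟨j, hj⟩).trans_lt hx
    have h2 := (dist_le_pi_dist (orbitMap T n y) (orbitMap T n e) ⟨j, hj⟩).trans_lt hy
    exact (dist_triangle_right _ _ _).trans (by simp only [orbitMap] at h1 h2; linarith)
  sum_le e x hx := birkhoffSum_le_add_of_dist_lt hω fun j hj =>
    (dist_le_pi_dist (orbitMap T n x) (orbitMap T n e) ⟨j, hj⟩).trans_lt hx

/-! ### The growth rate of the covering sums -/

lemma coverSum_ne_top [CompactSpace X] (hT : Continuous T) (hf : Continuous f) {ε : ℝ}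
    (hε : 0 < ε) (hε1 : ε ≤ 1) (n : ℕ) : coverSum T f n ε ≠ ⊤ := by
  obtain ⟨F, -, hF⟩ := exists_abs_le hf
  obtain ⟨E, -, hE⟩ := exists_finset_separated (continuous_orbitMap hT n) (ε := ε / 3)
    (by positivity)
  have := isWeightedCover_balls (f := f) hT (ε' := ε) (ω := F + F) (by positivity) (by linarith)
    (fun u v _ => (abs_sub _ _).trans (add_le_add (hF u) (hF v))) hE
  exact ((this.coverSum_le hε hε1).trans_lt ENNReal.ofReal_lt_top).ne

lemma le_coverSum [CompactSpace X] [Nonempty X] (hT : Continuous T) (hf : Continuous f) {ε F : ℝ}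
    (hε : 0 < ε) (hε1 : ε ≤ 1) (hF : ∀ x, |f x| ≤ F) (n : ℕ) :
    ENNReal.ofReal ((1 / ε) ^ (-(n * F))) ≤ coverSum T f n ε := by
  by_contra! h
  obtain ⟨m, U, s, hU, hlt⟩ := exists_isWeightedCover_of_coverSum_lt hT hf hε h
  obtain ⟨x⟩ := ‹Nonempty X›
  obtain ⟨i, hi⟩ := hU.exists_mem x
  have h1 : 1 ≤ 1 / ε := by rwa [le_div_iff₀ hε, one_mul]
  have h2 : (1 / ε) ^ (-(n * F)) ≤ (1 / ε) ^ s i :=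
    Real.rpow_le_rpow_of_exponent_le h1
      ((neg_le_of_abs_le (abs_birkhoffSum_le hF n x)).trans (hU.sum_le i x hi))
  have h3 : (1 / ε) ^ s i ≤ ∑ i, (1 / ε) ^ s i :=
    Finset.single_le_sum (f := fun i => (1 / ε) ^ s i) (fun i _ => by positivity)
      (Finset.mem_univ i)
  linarith

/-- `log R_n` as a real number. For a nonempty compact system `R_n` is positive and finite, see
`coverSum_eq_exp`. -/
def logCoverSum (T : X → X) (f : X → ℝ) (ε : ℝ) (n : ℕ) : ℝ := Real.log (coverSum T f n ε).toReal

section Rate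

variable [CompactSpace X] [Nonempty X] {ε : ℝ}

lemma coverSum_eq_exp (hT : Continuous T) (hf : Continuous f) (hε : 0 < ε) (hε1 : ε ≤ 1) (n : ℕ) :
    coverSum T f n ε = ENNReal.ofReal (Real.exp (logCoverSum T f ε n)) := by
  obtain ⟨F, -, hF⟩ := exists_abs_le hf
  have h0 : coverSum T f n ε ≠ 0 := fun h => by
    have := le_coverSum hT hf hε hε1 hF n
    rw [h, nonpos_iff_eq_zero, ENNReal.ofReal_eq_zero] at this
    exact absurd this (not_le.2 (by positivity))
  have ht := coverSum_ne_top hT hf hε hε1 n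
  rw [logCoverSum, Real.exp_log (ENNReal.toReal_pos h0 ht), ENNReal.ofReal_toReal ht]

lemma IsWeightedCover.exp_logCoverSum_le (hT : Continuous T) (hf : Continuous f) (hε : 0 < ε)
    (hε1 : ε ≤ 1) {n : ℕ} {ι : Type*} [Fintype ι] {U : ι → Set X} {s : ι → ℝ}
    (h : IsWeightedCover T f n ε U s) :
    Real.exp (logCoverSum T f ε n) ≤ ∑ i, (1 / ε) ^ s i := by
  have := h.coverSum_le hε hε1
  rw [coverSum_eq_exp hT hf hε hε1] at this
  exact (ENNReal.ofReal_le_ofReal_iff (Finset.sum_nonneg fun i _ => by positivity)).1 this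

/-- Weighted covers whose sum exceeds the infimum by a factor less than `exp τ`. -/
lemma exists_isWeightedCover (hT : Continuous T) (hf : Continuous f) (hε : 0 < ε) (hε1 : ε ≤ 1)
    (n : ℕ) {τ : ℝ} (hτ : 0 < τ) :
    ∃ (m : ℕ) (U : Fin m → Set X) (s : Fin m → ℝ), IsWeightedCover T f n ε U s ∧
      ∑ i, (1 / ε) ^ s i < Real.exp (logCoverSum T f ε n + τ) := by
  refine exists_isWeightedCover_of_coverSum_lt hT hf hε ?_
  rw [coverSum_eq_exp hT hf hε hε1]
  exact (ENNReal.ofReal_lt_ofReal_iff (Real.exp_pos _)).2 (Real.exp_lt_exp.2 (by linarith))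

lemma le_logCoverSum (hT : Continuous T) (hf : Continuous f) (hε : 0 < ε) (hε1 : ε ≤ 1) {F : ℝ}
    (hF : ∀ x, |f x| ≤ F) (n : ℕ) : -(n * F) * Real.log (1 / ε) ≤ logCoverSum T f ε n := by
  have h := le_coverSum hT hf hε hε1 hF n
  rw [coverSum_eq_exp hT hf hε hε1, ENNReal.ofReal_le_ofReal_iff (Real.exp_pos _).le] at h
  have h' := Real.log_le_log (by positivity) h
  rwa [Real.log_exp, Real.log_rpow (by positivity)] at h'

lemma logCoverSum_subadditive (hT : Continuous T) (hf : Continuous f) (hε : 0 < ε)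
    (hε1 : ε ≤ 1) : Subadditive (logCoverSum T f ε) := by
  intro p q
  refine le_of_forall_pos_le_add fun τ hτ => ?_
  obtain ⟨m, U, s, hU, hUs⟩ := exists_isWeightedCover hT hf hε hε1 p (half_pos hτ)
  obtain ⟨m', V, t, hV, hVt⟩ := exists_isWeightedCover hT hf hε hε1 q (half_pos hτ)
  have hW : IsWeightedCover T f (p + q) ε (fun k : Fin m × Fin m' => U k.1 ∩ T^[p] ⁻¹' V k.2)
      (fun k => s k.1 + t k.2) := by
    refine ⟨fun k => (hU.isOpen _).inter ((hV.isOpen _).preimage (hT.iterate p)), fun x => ?_,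
      fun k => ?_, fun k x hx => ?_⟩
    · obtain ⟨i, hi⟩ := hU.exists_mem x
      obtain ⟨j, hj⟩ := hV.exists_mem (T^[p] x)
      exact ⟨(i, j), hi, hj⟩
    · refine bowenDiam_lt hε (max_lt (hU.diam_lt k.1) (hV.diam_lt k.2)) fun x hx y hy j hj => ?_
      rcases lt_or_ge j p with h | h
      · exact (dist_iterate_le_bowenDiam hx.1 hy.1 h).trans (le_max_left _ _)
      · obtain ⟨l, rfl⟩ := Nat.exists_eq_add_of_le' h
        rw [Function.iterate_add_apply, Function.iterate_add_apply]
        exact (dist_iterate_le_bowenDiam (U := V k.2) hx.2 hy.2 (by omega)).trans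
          (le_max_right _ _)
    · rw [birkhoffSum_add]
      exact add_le_add (hU.sum_le _ _ hx.1) (hV.sum_le _ _ hx.2)
  have h := hW.exp_logCoverSum_le hT hf hε hε1
  have hprod : ∑ k : Fin m × Fin m', (1 / ε) ^ (s k.1 + t k.2) =
      (∑ i, (1 / ε) ^ s i) * ∑ j, (1 / ε) ^ t j := by
    rw [Fintype.sum_prod_type, Finset.sum_mul_sum]
    exact Finset.sum_congr rfl fun i _ => Finset.sum_congr rfl fun j _ =>
      Real.rpow_add (by positivity) _ _
  rw [hprod] at h
  have h2 := h.trans (mul_le_mul hUs.le hVt.le (Finset.sum_nonneg fun i _ => by positivity)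
    (Real.exp_pos _).le)
  rw [← Real.exp_add, Real.exp_le_exp] at h2
  linarith

/-- The limit of `log R_n / n`. -/
lemma exists_tendsto_logCoverSum (hT : Continuous T) (hf : Continuous f) (hε : 0 < ε)
    (hε1 : ε ≤ 1) : ∃ r : ℝ, Tendsto (fun n : ℕ => logCoverSum T f ε n / n) atTop (𝓝 r) ∧
      coverRate T f ε = r := by
  obtain ⟨F, hF0, hF⟩ := exists_abs_le hf
  have hlog : 0 ≤ Real.log (1 / ε) := Real.log_nonneg (by rwa [le_div_iff₀ hε, one_mul])
  have hb : BddBelow (range fun n : ℕ => logCoverSum T f ε n / n) := by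
    refine ⟨-F * Real.log (1 / ε), ?_⟩
    rintro _ ⟨n, rfl⟩
    rcases Nat.eq_zero_or_pos n with rfl | hn
    · have := mul_nonneg hF0 hlog
      simp only [Nat.cast_zero, div_zero]
      linarith
    · have hn' : (0 : ℝ) < n := by exact_mod_cast hn
      simp only
      rw [le_div_iff₀ hn']
      linarith [le_logCoverSum hT hf hε hε1 hF n]
  have hlim := (logCoverSum_subadditive hT hf hε hε1).tendsto_lim hb
  refine ⟨_, hlim, ?_⟩
  have hE : (fun n : ℕ => ENNReal.log (coverSum T f n ε) / (n : EReal)) =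
      fun n : ℕ => ((logCoverSum T f ε n / n : ℝ) : EReal) := by
    funext n
    rw [coverSum_eq_exp hT hf hε hε1, ENNReal.log_ofReal_of_pos (Real.exp_pos _), Real.log_exp,
      EReal.coe_div, EReal.coe_natCast]
  rw [coverRate, hE]
  exact (EReal.tendsto_coe.2 hlim).limsup_eq

/-- Points that are `ε`-separated for the Bowen metric lie in different members of a cover. -/
lemma sum_le_exp_logCoverSum_of_separated (hT : Continuous T) (hf : Continuous f) (hε : 0 < ε)
    (hε1 : ε ≤ 1) {n : ℕ} {E : Finset X}
    (hE : ∀ x ∈ E, ∀ y ∈ E, x ≠ y → ε ≤ dist (orbitMap T n x) (orbitMap T n y)) :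
    ∑ e ∈ E, (1 / ε) ^ birkhoffSum T f n e ≤ Real.exp (logCoverSum T f ε n) := by
  refine le_of_forall_gt_imp_ge_of_dense fun v hv => ?_
  obtain ⟨m, U, s, hU, hlt⟩ := exists_isWeightedCover_of_coverSum_lt hT hf hε (n := n) (v := v) <| by
    rw [coverSum_eq_exp hT hf hε hε1]
    exact (ENNReal.ofReal_lt_ofReal_iff ((Real.exp_pos _).trans hv)).2 hv
  have h1 : 1 ≤ 1 / ε := by rwa [le_div_iff₀ hε, one_mul]
  choose i hi using hU.exists_mem
  have hinj : Set.InjOn i E := fun x hx y hy hxy => by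
    by_contra hne
    have h := Metric.dist_le_diam_of_mem (Metric.isBounded_of_compactSpace)
      (mem_image_of_mem (orbitMap T n) (hi x)) (mem_image_of_mem (orbitMap T n) (hxy ▸ hi y))
    exact absurd ((hE x hx y hy hne).trans h) (not_le.2 (hU.diam_lt _))
  calc ∑ e ∈ E, (1 / ε) ^ birkhoffSum T f n e ≤ ∑ e ∈ E, (1 / ε) ^ s (i e) :=
        Finset.sum_le_sum fun e _ =>
          Real.rpow_le_rpow_of_exponent_le h1 (hU.sum_le _ _ (hi e))
    _ = ∑ k ∈ E.image i, (1 / ε) ^ s k :=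
        (Finset.sum_image (f := fun k => (1 / ε) ^ s k) hinj).symm
    _ ≤ ∑ k, (1 / ε) ^ s k :=
        Finset.sum_le_sum_of_subset_of_nonneg (Finset.subset_univ _)
          fun k _ _ => by positivity
    _ ≤ v := hlt.le

/-- The converse comparison, at the coarser scale `3 * ε`: passing from the base `1 / ε` to
`1 / (3 * ε)` and from the supremum over a Bowen ball to the value at its centre costs factors
that are exponential in `n`. -/
lemma logCoverSum_three_mul_le (hT : Continuous T) (hf : Continuous f) (hε : 0 < ε)
    (hε1 : 3 * ε ≤ 1) {n : ℕ} {F ω : ℝ} (hF : ∀ x, |f x| ≤ F) (hω0 : 0 ≤ ω)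
    (hω : ∀ u v, dist u v < ε → |f u - f v| ≤ ω) {E : Finset X}
    (hE : ∀ x, ∃ e ∈ E, dist (orbitMap T n x) (orbitMap T n e) < ε) :
    logCoverSum T f (3 * ε) n ≤ n * (ω * Real.log (1 / ε) + F * Real.log 3) +
      Real.log (∑ e ∈ E, (1 / ε) ^ birkhoffSum T f n e) := by
  have hcov := isWeightedCover_balls hT (n := n) hε (ε' := 3 * ε) (by linarith) hω hE
  have h := hcov.exp_logCoverSum_le hT hf (by positivity) hε1
  have hne : E.Nonempty := by
    obtain ⟨x⟩ := ‹Nonempty X›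
    obtain ⟨e, he, -⟩ := hE x
    exact ⟨e, he⟩
  have hpos : 0 < ∑ e ∈ E, (1 / ε) ^ birkhoffSum T f n e :=
    Finset.sum_pos (fun e _ => by positivity) hne
  have hterm : ∀ e : X, (1 / (3 * ε)) ^ (birkhoffSum T f n e + n * ω) ≤
      (3 : ℝ) ^ (n * F) * (1 / ε) ^ (n * ω) * (1 / ε) ^ birkhoffSum T f n e := fun e => by
    have h3 : (1 / (3 * ε) : ℝ) = 3⁻¹ * (1 / ε) := by rw [one_div, mul_inv, one_div]
    have hlow : -(birkhoffSum T f n e + n * ω) ≤ n * F := by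
      have := neg_le_of_abs_le (abs_birkhoffSum_le (T := T) hF n e)
      have : 0 ≤ n * ω := by positivity
      linarith
    rw [h3, Real.mul_rpow (by positivity) (by positivity), Real.inv_rpow (by norm_num),
      ← Real.rpow_neg (by norm_num), mul_assoc, ← Real.rpow_add (by positivity),
      add_comm (n * ω)]
    exact mul_le_mul_of_nonneg_right
      (Real.rpow_le_rpow_of_exponent_le (by norm_num) hlow) (by positivity)
  have h' : Real.exp (logCoverSum T f (3 * ε) n) ≤
      (3 : ℝ) ^ (n * F) * (1 / ε) ^ (n * ω) * ∑ e ∈ E, (1 / ε) ^ birkhoffSum T f n e := by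
    refine h.trans ?_
    rw [Finset.mul_sum]
    exact (Finset.sum_le_sum fun (e : E) _ => hterm e).trans (Finset.sum_coe_sort E fun e =>
      (3 : ℝ) ^ (n * F) * (1 / ε) ^ (n * ω) * (1 / ε) ^ birkhoffSum T f n e).le
  have h'' := Real.log_le_log (Real.exp_pos _) h'
  rw [Real.log_exp, Real.log_mul (by positivity) hpos.ne',
    Real.log_mul (by positivity) (by positivity), Real.log_rpow (by norm_num),
    Real.log_rpow (by positivity)] at h''
  linarith

lemma log_one_div_pos (hε : 0 < ε) (hε1 : ε < 1) : 0 < Real.log (1 / ε) :=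
  Real.log_pos (by rwa [lt_div_iff₀ hε, one_mul])

lemma eventually_mem_Ioo {b : ℝ} (hb : 0 < b) : ∀ᶠ ε : ℝ in 𝓝[>] 0, 0 < ε ∧ ε < b :=
  Ioo_mem_nhdsGT hb

lemma tendsto_log_one_div : Tendsto (fun ε : ℝ => Real.log (1 / ε)) (𝓝[>] 0) atTop := by
  simpa only [one_div, Function.comp_def] using Real.tendsto_log_atTop.comp tendsto_inv_nhdsGT_zero

lemma neg_le_coverRate_div (hT : Continuous T) (hf : Continuous f) {F : ℝ}
    (hF : ∀ x, |f x| ≤ F) (hε : 0 < ε) (hε1 : ε < 1) :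
    ((-F : ℝ) : EReal) ≤ coverRate T f ε / (Real.log (1 / ε) : EReal) := by
  obtain ⟨r, hr, h⟩ := exists_tendsto_logCoverSum hT hf hε hε1.le
  have hl := log_one_div_pos hε hε1
  rw [h, ← EReal.coe_div, EReal.coe_le_coe_iff, le_div_iff₀ hl]
  refine ge_of_tendsto hr ?_
  filter_upwards [eventually_gt_atTop 0] with n hn
  have hn' : (0 : ℝ) < n := by exact_mod_cast hn
  rw [le_div_iff₀ hn']
  linarith [le_logCoverSum hT hf hε hε1.le hF n]

lemma lowerMetricMeanDim_ne_bot (hT : Continuous T) (hf : Continuous f) :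
    lowerMetricMeanDim T f ≠ ⊥ := by
  obtain ⟨F, -, hF⟩ := exists_abs_le hf
  refine ne_bot_of_le_ne_bot (EReal.coe_ne_bot (-F)) (le_liminf_of_le (by isBoundedDefault) ?_)
  filter_upwards [eventually_mem_Ioo one_pos] with ε hε
  exact neg_le_coverRate_div hT hf hF hε.1 hε.2

omit [CompactSpace X] [Nonempty X] in
lemma lowerMetricMeanDim_le_upperMetricMeanDim (T : X → X) (f : X → ℝ) :
    lowerMetricMeanDim T f ≤ upperMetricMeanDim T f :=
  liminf_le_limsup (by isBoundedDefault) (by isBoundedDefault)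

omit [Nonempty X] in
lemma eventually_abs_sub_le (hf : Continuous f) {ω : ℝ} (hω : 0 < ω) :
    ∀ᶠ ε : ℝ in 𝓝[>] 0, ∀ u v, dist u v < ε → |f u - f v| ≤ ω := by
  obtain ⟨δ, hδ, h⟩ := Metric.uniformContinuous_iff.1
    (CompactSpace.uniformContinuous_of_continuous hf) ω hω
  filter_upwards [eventually_mem_Ioo hδ] with ε hε u v huv
  exact (h (huv.trans hε.2)).le

end Rate

end Covers

/-! ### Empty systems -/

lemma upperMetricMeanDim_of_isEmpty {X : Type*} [MetricSpace X] [IsEmpty X] (T : X → X)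
    (f : X → ℝ) : upperMetricMeanDim T f = ⊥ := by
  have h0 : ∀ n ε, coverSum T f n ε = 0 := fun n ε => by
    refine le_antisymm ?_ zero_le
    unfold coverSum
    refine iInf_le_of_le 0 ?_
    refine iInf_le_of_le (fun _ => ∅) ?_
    refine iInf_le_of_le (fun i => i.elim0) ?_
    refine iInf_le_of_le (Subsingleton.elim _ _) ?_
    exact iInf_le_of_le (fun i => i.elim0) (by simp)
  have h1 : ∀ ε, coverRate T f ε = ⊥ := fun ε => by
    refine (tendsto_const_nhds.congr' ?_).limsup_eq
    filter_upwards [eventually_gt_atTop 0] with n hn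
    rw [h0, ENNReal.log_zero, EReal.bot_div_of_pos_ne_top (by exact_mod_cast hn)
      (EReal.natCast_ne_top n)]
  refine (tendsto_const_nhds.congr' ?_).limsup_eq
  filter_upwards [eventually_mem_Ioo one_pos] with ε hε
  rw [h1, EReal.bot_div_of_pos_ne_top (by exact_mod_cast log_one_div_pos hε.1 hε.2)
    (EReal.coe_ne_top _)]

lemma lowerMetricMeanDim_of_isEmpty {X : Type*} [MetricSpace X] [IsEmpty X] (T : X → X)
    (f : X → ℝ) : lowerMetricMeanDim T f = ⊥ :=
  le_bot_iff.1 ((lowerMetricMeanDim_le_upperMetricMeanDim T f).trans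
    (upperMetricMeanDim_of_isEmpty T f).le)

/-! ### Product systems -/

section Prod

variable {X₁ X₂ : Type*} {T₁ : X₁ → X₁} {T₂ : X₂ → X₂} {f₁ : X₁ → ℝ} {f₂ : X₂ → ℝ}

lemma birkhoffSum_prodMap (n : ℕ) (p : X₁ × X₂) :
    birkhoffSum (Prod.map T₁ T₂) (fun p : X₁ × X₂ => f₁ p.1 + f₂ p.2) n p =
      birkhoffSum T₁ f₁ n p.1 + birkhoffSum T₂ f₂ n p.2 := by
  simp [birkhoffSum, Finset.sum_add_distrib, Prod.map_iterate]

variable [MetricSpace X₁] [MetricSpace X₂]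

lemma dist_orbitMap_prodMap (n : ℕ) (p q : X₁ × X₂) :
    dist (orbitMap (Prod.map T₁ T₂) n p) (orbitMap (Prod.map T₁ T₂) n q) =
      max (dist (orbitMap T₁ n p.1) (orbitMap T₁ n q.1))
        (dist (orbitMap T₂ n p.2) (orbitMap T₂ n q.2)) := by
  refine eq_of_forall_ge_iff fun c => ?_
  rcases lt_or_ge c 0 with hc | hc
  · exact ⟨fun h => absurd (dist_nonneg.trans h) (not_le.2 hc),
      fun h => absurd (dist_nonneg.trans ((le_max_left _ _).trans h)) (not_le.2 hc)⟩
  · simp [dist_pi_le_iff hc, orbitMap, Prod.map_iterate, Prod.dist_eq, forall_and]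

variable [CompactSpace X₁] [CompactSpace X₂]

lemma IsWeightedCover.prod {n : ℕ} {ε : ℝ} (hε : 0 < ε) {ι κ : Type*} {U : ι → Set X₁} {s : ι → ℝ}
    {V : κ → Set X₂} {t : κ → ℝ} (hU : IsWeightedCover T₁ f₁ n ε U s)
    (hV : IsWeightedCover T₂ f₂ n ε V t) :
    IsWeightedCover (Prod.map T₁ T₂) (fun p : X₁ × X₂ => f₁ p.1 + f₂ p.2) n ε
      (fun k : ι × κ => U k.1 ×ˢ V k.2) (fun k => s k.1 + t k.2) where
  isOpen k := (hU.isOpen _).prod (hV.isOpen _)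
  exists_mem x := by
    obtain ⟨i, hi⟩ := hU.exists_mem x.1
    obtain ⟨j, hj⟩ := hV.exists_mem x.2
    exact ⟨(i, j), hi, hj⟩
  diam_lt k := by
    refine bowenDiam_lt hε (max_lt (hU.diam_lt k.1) (hV.diam_lt k.2)) fun x hx y hy j hj => ?_
    rw [Prod.map_iterate, Prod.dist_eq]
    exact max_le_max (dist_iterate_le_bowenDiam hx.1 hy.1 hj)
      (dist_iterate_le_bowenDiam hx.2 hy.2 hj)
  sum_le k x hx := by
    rw [birkhoffSum_prodMap]
    exact add_le_add (hU.sum_le _ _ hx.1) (hV.sum_le _ _ hx.2)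

variable [Nonempty X₁] [Nonempty X₂]

lemma logCoverSum_prodMap_le (hT₁ : Continuous T₁) (hT₂ : Continuous T₂) (hf₁ : Continuous f₁)
    (hf₂ : Continuous f₂) {ε : ℝ} (hε : 0 < ε) (hε1 : ε ≤ 1) (n : ℕ) :
    logCoverSum (Prod.map T₁ T₂) (fun p : X₁ × X₂ => f₁ p.1 + f₂ p.2) ε n ≤
      logCoverSum T₁ f₁ ε n + logCoverSum T₂ f₂ ε n := by
  refine le_of_forall_pos_le_add fun τ hτ => ?_
  obtain ⟨m, U, s, hU, hUs⟩ := exists_isWeightedCover hT₁ hf₁ hε hε1 n (half_pos hτ)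
  obtain ⟨m', V, t, hV, hVt⟩ := exists_isWeightedCover hT₂ hf₂ hε hε1 n (half_pos hτ)
  have h := (hU.prod hε hV).exp_logCoverSum_le (hT₁.prodMap hT₂) (by fun_prop) hε hε1
  have hprod : ∑ k : Fin m × Fin m', (1 / ε) ^ (s k.1 + t k.2) =
      (∑ i, (1 / ε) ^ s i) * ∑ j, (1 / ε) ^ t j := by
    rw [Fintype.sum_prod_type, Finset.sum_mul_sum]
    exact Finset.sum_congr rfl fun i _ => Finset.sum_congr rfl fun j _ =>
      Real.rpow_add (by positivity) _ _
  rw [hprod] at h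
  have h2 := h.trans (mul_le_mul hUs.le hVt.le (Finset.sum_nonneg fun i _ => by positivity)
    (Real.exp_pos _).le)
  rw [← Real.exp_add, Real.exp_le_exp] at h2
  linarith

lemma logCoverSum_add_le (hT₁ : Continuous T₁) (hT₂ : Continuous T₂) (hf₁ : Continuous f₁)
    (hf₂ : Continuous f₂) {ε F₁ F₂ ω : ℝ} (hε : 0 < ε) (hε1 : 3 * ε ≤ 1) (hF₁ : ∀ x, |f₁ x| ≤ F₁)
    (hF₂ : ∀ x, |f₂ x| ≤ F₂) (hω0 : 0 ≤ ω) (hω₁ : ∀ u v, dist u v < ε → |f₁ u - f₁ v| ≤ ω)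
    (hω₂ : ∀ u v, dist u v < ε → |f₂ u - f₂ v| ≤ ω) (n : ℕ) :
    logCoverSum T₁ f₁ (3 * ε) n + logCoverSum T₂ f₂ (3 * ε) n ≤
      logCoverSum (Prod.map T₁ T₂) (fun p : X₁ × X₂ => f₁ p.1 + f₂ p.2) ε n +
        n * (2 * ω * Real.log (1 / ε) + (F₁ + F₂) * Real.log 3) := by
  classical
  obtain ⟨E₁, hsep₁, hE₁⟩ := exists_finset_separated (continuous_orbitMap hT₁ n) hε
  obtain ⟨E₂, hsep₂, hE₂⟩ := exists_finset_separated (continuous_orbitMap hT₂ n) hε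
  have h₁ := logCoverSum_three_mul_le hT₁ hf₁ hε hε1 hF₁ hω0 hω₁ hE₁
  have h₂ := logCoverSum_three_mul_le hT₂ hf₂ hε hε1 hF₂ hω0 hω₂ hE₂
  have hpos₁ : 0 < ∑ e ∈ E₁, (1 / ε) ^ birkhoffSum T₁ f₁ n e :=
    Finset.sum_pos (fun e _ => by positivity)
      (let ⟨e, he, _⟩ := hE₁ (Classical.arbitrary X₁); ⟨e, he⟩)
  have hpos₂ : 0 < ∑ e ∈ E₂, (1 / ε) ^ birkhoffSum T₂ f₂ n e :=
    Finset.sum_pos (fun e _ => by positivity)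
      (let ⟨e, he, _⟩ := hE₂ (Classical.arbitrary X₂); ⟨e, he⟩)
  -- A product of separated sets is separated for the max metric.
  have h := sum_le_exp_logCoverSum_of_separated (f := fun p : X₁ × X₂ => f₁ p.1 + f₂ p.2)
    (hT₁.prodMap hT₂) (by fun_prop) hε (by linarith) (n := n) (E := E₁ ×ˢ E₂) <| by
      intro x hx y hy hxy
      rw [Finset.mem_product] at hx hy
      rw [dist_orbitMap_prodMap]
      by_cases h : x.1 = y.1
      · exact le_max_of_le_right (hsep₂ _ hx.2 _ hy.2 fun h' => hxy (Prod.ext h h'))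
      · exact le_max_of_le_left (hsep₁ _ hx.1 _ hy.1 h)
  have hprod : ∑ e ∈ E₁ ×ˢ E₂,
      (1 / ε) ^ birkhoffSum (Prod.map T₁ T₂) (fun p : X₁ × X₂ => f₁ p.1 + f₂ p.2) n e =
      (∑ e ∈ E₁, (1 / ε) ^ birkhoffSum T₁ f₁ n e) *
        ∑ e ∈ E₂, (1 / ε) ^ birkhoffSum T₂ f₂ n e := by
    rw [Finset.sum_product, Finset.sum_mul_sum]
    refine Finset.sum_congr rfl fun i _ => Finset.sum_congr rfl fun j _ => ?_
    rw [birkhoffSum_prodMap, Real.rpow_add (by positivity)]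
  rw [hprod] at h
  have h' := Real.log_le_log (mul_pos hpos₁ hpos₂) h
  rw [Real.log_exp, Real.log_mul hpos₁.ne' hpos₂.ne'] at h'
  linarith

theorem upperMetricMeanDim_prodMap_le (hT₁ : Continuous T₁) (hT₂ : Continuous T₂)
    (hf₁ : Continuous f₁) (hf₂ : Continuous f₂) :
    upperMetricMeanDim (Prod.map T₁ T₂) (fun p : X₁ × X₂ => f₁ p.1 + f₂ p.2) ≤
      upperMetricMeanDim T₁ f₁ + upperMetricMeanDim T₂ f₂ := by
  refine le_trans ?_ (EReal.limsup_add_le (Or.inl ?_) (Or.inr ?_))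
  · refine limsup_le_limsup ?_ (by isBoundedDefault) (by isBoundedDefault)
    filter_upwards [eventually_mem_Ioo one_pos] with ε hε
    obtain ⟨r₁, hr₁, h₁⟩ := exists_tendsto_logCoverSum hT₁ hf₁ hε.1 hε.2.le
    obtain ⟨r₂, hr₂, h₂⟩ := exists_tendsto_logCoverSum hT₂ hf₂ hε.1 hε.2.le
    obtain ⟨r, hr, h⟩ := exists_tendsto_logCoverSum (hT₁.prodMap hT₂)
      (f := fun p : X₁ × X₂ => f₁ p.1 + f₂ p.2) (by fun_prop) hε.1 hε.2.le
    have hle : r ≤ r₁ + r₂ := le_of_tendsto_of_tendsto' hr (hr₁.add hr₂) fun n => by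
      rw [← add_div]
      gcongr
      exact logCoverSum_prodMap_le hT₁ hT₂ hf₁ hf₂ hε.1 hε.2.le n
    simp only [Pi.add_apply]
    rw [h, h₁, h₂, ← EReal.coe_div, ← EReal.coe_div, ← EReal.coe_div, ← EReal.coe_add,
      EReal.coe_le_coe_iff, ← add_div]
    have := (log_one_div_pos hε.1 hε.2).le
    gcongr
  · exact ne_bot_of_le_ne_bot (lowerMetricMeanDim_ne_bot hT₁ hf₁)
      (lowerMetricMeanDim_le_upperMetricMeanDim _ _)
  · exact ne_bot_of_le_ne_bot (lowerMetricMeanDim_ne_bot hT₂ hf₂)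
      (lowerMetricMeanDim_le_upperMetricMeanDim _ _)

theorem lowerMetricMeanDim_add_le_prodMap (hT₁ : Continuous T₁) (hT₂ : Continuous T₂)
    (hf₁ : Continuous f₁) (hf₂ : Continuous f₂) :
    lowerMetricMeanDim T₁ f₁ + lowerMetricMeanDim T₂ f₂ ≤
      lowerMetricMeanDim (Prod.map T₁ T₂) (fun p : X₁ × X₂ => f₁ p.1 + f₂ p.2) := by
  refine EReal.add_le_of_forall_lt fun a ha b hb => ?_
  induction a with
  | bot => simp
  | top => exact absurd ha not_top_lt
  | coe a =>
  induction b with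
  | bot => simp
  | top => exact absurd hb not_top_lt
  | coe b =>
  rw [← EReal.coe_add]
  refine EReal.ge_of_forall_gt_iff_ge.1 fun c hc => ?_
  have hg : 0 < a + b - c := by linarith [EReal.coe_lt_coe_iff.1 hc]
  obtain ⟨F₁, -, hF₁⟩ := exists_abs_le hf₁
  obtain ⟨F₂, -, hF₂⟩ := exists_abs_le hf₂
  have h3 : Tendsto (fun ε : ℝ => 3 * ε) (𝓝[>] 0) (𝓝[>] 0) := by
    refine tendsto_nhdsWithin_iff.2 ⟨?_, ?_⟩
    · simpa using ((continuous_const_mul (3 : ℝ)).tendsto 0).mono_left nhdsWithin_le_nhds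
    · filter_upwards [self_mem_nhdsWithin] with ε hε
      exact mul_pos three_pos (mem_Ioi.1 hε)
  refine le_liminf_of_le (by isBoundedDefault) ?_
  filter_upwards [eventually_mem_Ioo (b := 1 / 3) (by norm_num),
    h3.eventually (eventually_lt_of_lt_liminf ha), h3.eventually (eventually_lt_of_lt_liminf hb),
    eventually_abs_sub_le hf₁ (ω := (a + b - c) / 4) (by positivity),
    eventually_abs_sub_le hf₂ (ω := (a + b - c) / 4) (by positivity),
    tendsto_log_one_div.eventually_ge_atTop
      ((a + b + (F₁ + F₂)) * Real.log 3 / ((a + b - c) / 2))] with ε hε ha hb hω₁ hω₂ hl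
  obtain ⟨r₁, hr₁, h₁⟩ := exists_tendsto_logCoverSum hT₁ hf₁ (ε := 3 * ε) (by linarith)
    (by linarith)
  obtain ⟨r₂, hr₂, h₂⟩ := exists_tendsto_logCoverSum hT₂ hf₂ (ε := 3 * ε) (by linarith)
    (by linarith)
  obtain ⟨r, hr, h⟩ := exists_tendsto_logCoverSum (hT₁.prodMap hT₂)
    (f := fun p : X₁ × X₂ => f₁ p.1 + f₂ p.2) (by fun_prop) hε.1 (by linarith)
  have hle : r₁ + r₂ ≤
      r + (2 * ((a + b - c) / 4) * Real.log (1 / ε) + (F₁ + F₂) * Real.log 3) := by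
    refine le_of_tendsto_of_tendsto (hr₁.add hr₂) (hr.add tendsto_const_nhds) ?_
    filter_upwards [eventually_gt_atTop 0] with n hn
    have hn' : (0 : ℝ) < n := by exact_mod_cast hn
    rw [← add_div, div_le_iff₀ hn', add_mul, div_mul_cancel₀ _ hn'.ne', mul_comm _ (n : ℝ)]
    exact logCoverSum_add_le hT₁ hT₂ hf₁ hf₂ hε.1 (by linarith) hF₁ hF₂ (by positivity)
      hω₁ hω₂ n
  have hl3 := log_one_div_pos (ε := 3 * ε) (by linarith) (by linarith)
  have hlog : Real.log (1 / (3 * ε)) = Real.log (1 / ε) - Real.log 3 := by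
    rw [one_div, mul_inv, mul_comm, Real.log_mul (inv_pos.2 hε.1).ne' (by norm_num), Real.log_inv 3,
      one_div, sub_eq_add_neg]
  rw [h₁, ← EReal.coe_div, EReal.coe_lt_coe_iff, lt_div_iff₀ hl3, hlog] at ha
  rw [h₂, ← EReal.coe_div, EReal.coe_lt_coe_iff, lt_div_iff₀ hl3, hlog] at hb
  rw [h, ← EReal.coe_div, EReal.coe_le_coe_iff,
    le_div_iff₀ (log_one_div_pos hε.1 (by linarith))]
  rw [div_le_iff₀ (by positivity)] at hl
  linarith

end Prod

/-! ### The nerve of a cover and the width dimension -/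

section Nerve

variable {X : Type*} {m : ℕ}

/-- The nerve of a family `U` of sets, realised in `ℝ^m` with the standard basis as vertices: the
simplices are spanned by the nonempty sets of indices whose members have a common point. -/
def nerveComplex (U : Fin m → Set X) : Geometry.SimplicialComplex ℝ (Fin m → ℝ) :=
  Geometry.SimplicialComplex.ofAffineIndependent
    (PreAbstractSimplicialComplex.map
      { faces := {t : Finset (Fin m) | t.Nonempty ∧ ∃ x, ∀ i ∈ t, x ∈ U i}
        isRelLowerSet_faces := fun _ ht =>
          ⟨ht.1, fun _ hsub hs => ⟨hs, ht.2.imp fun _ hx i hi => hx i (hsub hi)⟩⟩ }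
      (fun i => Pi.single i (1 : ℝ)))
    (by
      refine (Pi.linearIndependent_single_one (Fin m) ℝ).affineIndependent.range.mono fun x hx => ?_
      simp only [Set.mem_iUnion, Finset.mem_coe] at hx
      obtain ⟨_, ⟨_, _, rfl⟩, hx⟩ := hx
      obtain ⟨i, -, rfl⟩ := Finset.mem_image.1 hx
      exact mem_range_self i)

lemma mem_faces_nerveComplex {U : Fin m → Set X} {s : Finset (Fin m → ℝ)} :
    s ∈ (nerveComplex U).faces ↔ ∃ t : Finset (Fin m), (t.Nonempty ∧ ∃ x, ∀ i ∈ t, x ∈ U i) ∧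
      t.image (fun i => Pi.single i (1 : ℝ)) = s :=
  Iff.rfl

lemma finite_faces_nerveComplex (U : Fin m → Set X) : (nerveComplex U).faces.Finite :=
  (Set.toFinite {t : Finset (Fin m) | t.Nonempty ∧ ∃ x, ∀ i ∈ t, x ∈ U i}).image _

lemma eq_zero_of_mem_convexHull_single {t : Finset (Fin m)} {a : Fin m → ℝ}
    (ha : a ∈ convexHull ℝ ((t.image fun i => Pi.single i (1 : ℝ) : Finset (Fin m → ℝ)) :
      Set (Fin m → ℝ))) {i : Fin m} (hi : i ∉ t) : a i = 0 := by
  have hc : Convex ℝ {a : Fin m → ℝ | a i = 0} := fun a ha b hb p q _ _ _ => by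
    simp only [mem_ofPred_eq] at ha hb
    simp [ha, hb]
  refine convexHull_min ?_ hc ha
  intro b hb
  obtain ⟨j, hj, rfl⟩ := Finset.mem_image.1 hb
  have : i ≠ j := fun h => hi (h ▸ hj)
  simp [this]

lemma mem_convexHull_single {t : Finset (Fin m)} {a : Fin m → ℝ} (h0 : ∀ i, 0 ≤ a i)
    (h1 : ∑ i, a i = 1) (ht : ∀ i ∉ t, a i = 0) :
    a ∈ convexHull ℝ ((t.image fun i => Pi.single i (1 : ℝ) : Finset (Fin m → ℝ)) :
      Set (Fin m → ℝ)) := by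
  have hsum : ∑ i ∈ t, a i • (Pi.single i (1 : ℝ) : Fin m → ℝ) = a := by
    ext k
    rw [Finset.sum_apply]
    simp only [Pi.smul_apply, Pi.single_apply, smul_eq_mul, mul_ite, mul_one, mul_zero,
      Finset.sum_ite_eq]
    split_ifs with hk
    · rfl
    · exact (ht k hk).symm
  rw [← hsum]
  refine (convex_convexHull ℝ _).sum_mem (fun i _ => h0 i) ?_ fun i hi =>
    subset_convexHull ℝ _ (Finset.mem_coe.2 (Finset.mem_image_of_mem _ hi))
  rw [← h1]
  exact Finset.sum_subset (Finset.subset_univ _) fun i _ hi => ht i hi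

variable [MetricSpace X] {T : X → X} {f : X → ℝ} {n : ℕ} {ε : ℝ}

/-- A partition of unity maps `X` to the nerve of a cover `U`. The simplices containing the image
of `x` are given by common points `y` of several members, one of which contains `x`; hence the
local dimension at `x` is at most the order of `U` at `y`, less one, and the Birkhoff sums at `x`
and `y` are close. -/
lemma widim_le_of_openCover_fin (hε : 0 < ε) {U : Fin m → Set X}
    (hUo : ∀ i, IsOpen (U i)) (hUc : ∀ x, ∃ i, x ∈ U i) (hUd : ∀ i, bowenDiam T n (U i) < ε)
    {κ B : ℝ} (hκ : ∀ i, ∀ x ∈ U i, ∀ y ∈ U i, birkhoffSum T f n x ≤ birkhoffSum T f n y + κ)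
    (hB : ∀ y, ({i | y ∈ U i}.ncard : ℝ) - 1 + birkhoffSum T f n y ≤ B)
    (hbdd : ∀ i, Bornology.IsBounded (orbitMap T n '' U i)) :
    widim T f n ε ≤ ((B + κ : ℝ) : EReal) := by
  classical
  obtain ⟨ρ, hρ⟩ := PartitionOfUnity.exists_isSubordinate isClosed_univ U hUo
    fun x _ => mem_iUnion.2 (hUc x)
  have hmem : ∀ i x, ρ i x ≠ 0 → x ∈ U i := fun i x h => hρ i (subset_tsupport _ h)
  have hsum : ∀ x, ∑ i, ρ i x = 1 := fun x => by
    rw [← ρ.sum_eq_one (mem_univ x), finsum_eq_sum_of_fintype]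
  have hex : ∀ x, ∃ i, ρ i x ≠ 0 := fun x => by
    by_contra! h
    simpa [h] using hsum x
  have hspace : ∀ x, (fun i => ρ i x) ∈ (nerveComplex U).space := fun x => by
    refine Geometry.SimplicialComplex.mem_space_iff.2
      ⟨_, mem_faces_nerveComplex.2 ⟨Finset.univ.filter fun i => ρ i x ≠ 0, ⟨?_, x, ?_⟩, rfl⟩,
        mem_convexHull_single (fun i => ρ.nonneg i x) (hsum x) fun i hi => ?_⟩
    · obtain ⟨i, hi⟩ := hex x
      exact ⟨i, by simpa using hi⟩
    · exact fun i hi => hmem i x (Finset.mem_filter.1 hi).2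
    · simpa using hi
  let g : C(X, (nerveComplex U).space) :=
    ⟨fun x => ⟨fun i => ρ i x, hspace x⟩,
      (continuous_pi fun i => (ρ i).continuous).subtype_mk _⟩
  have hfib : ∀ y : (nerveComplex U).space, bowenDiam T n (g ⁻¹' {y}) < ε := fun y => by
    rcases (g ⁻¹' {y}).eq_empty_or_nonempty with h | ⟨x, hx⟩
    · rw [h]
      simpa [bowenDiam] using hε
    · obtain ⟨i, hi⟩ := hex x
      refine (Metric.diam_mono (image_mono fun z hz => hmem i z ?_) (hbdd i)).trans_lt (hUd i)
      have hzx : g z = g x := (mem_singleton_iff.1 hz).trans (mem_singleton_iff.1 hx).symm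
      rw [show ρ i z = ρ i x from congr_fun (congr_arg Subtype.val hzx) i]
      exact hi
  unfold widim
  refine iInf_le_of_le m ?_
  refine iInf_le_of_le (nerveComplex U) ?_
  refine iInf_le_of_le (finite_faces_nerveComplex U) ?_
  refine iInf_le_of_le g ?_
  refine iInf_le_of_le hfib ?_
  refine iSup_le fun x => ?_
  have hdim : localDim (nerveComplex U) (g x) ≤ ((B + κ - birkhoffSum T f n x : ℝ) : EReal) := by
    refine iSup_le fun s => iSup_le fun hs => iSup_le fun hxs => ?_
    obtain ⟨t, ⟨htne, y, hy⟩, rfl⟩ := mem_faces_nerveComplex.1 hs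
    obtain ⟨i, hi⟩ := hex x
    have hit : i ∈ t := by
      by_contra h
      exact hi (eq_zero_of_mem_convexHull_single hxs h)
    have hcard : (t.image fun i => (Pi.single i (1 : ℝ) : Fin m → ℝ)).card ≤
        {i | y ∈ U i}.ncard := by
      refine Finset.card_image_le.trans ?_
      rw [← Set.ncard_coe_finset]
      exact Set.ncard_le_ncard (fun i hi => hy i hi)
    have hpos : 1 ≤ (t.image fun i => (Pi.single i (1 : ℝ) : Fin m → ℝ)).card :=
      Finset.card_pos.2 (htne.image _)
    have h1 := hκ i x (hmem i x hi) y (hy i hit)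
    have h2 := hB y
    rw [← EReal.coe_natCast, EReal.coe_le_coe_iff, Nat.cast_sub hpos, Nat.cast_one]
    have h3 : ((t.image fun i => (Pi.single i (1 : ℝ) : Fin m → ℝ)).card : ℝ) ≤
      {i | y ∈ U i}.ncard := by exact_mod_cast hcard
    linarith
  refine (add_le_add_left hdim _).trans ?_
  rw [← EReal.coe_add, sub_add_cancel]

lemma widim_le_of_openCover [CompactSpace X] (hε : 0 < ε) {ι : Type*} [Fintype ι] {U : ι → Set X}
    (hUo : ∀ i, IsOpen (U i)) (hUc : ∀ x, ∃ i, x ∈ U i) (hUd : ∀ i, bowenDiam T n (U i) < ε)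
    {κ B : ℝ} (hκ : ∀ i, ∀ x ∈ U i, ∀ y ∈ U i, birkhoffSum T f n x ≤ birkhoffSum T f n y + κ)
    (hB : ∀ y, ({i | y ∈ U i}.ncard : ℝ) - 1 + birkhoffSum T f n y ≤ B) :
    widim T f n ε ≤ ((B + κ : ℝ) : EReal) := by
  let e := (Fintype.equivFin ι).symm
  refine widim_le_of_openCover_fin hε (U := fun k => U (e k)) (fun k => hUo _) (fun x => ?_)
    (fun k => hUd _) (fun k => hκ _) (fun y => ?_) fun k => Metric.isBounded_of_compactSpace
  · obtain ⟨i, hi⟩ := hUc x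
    exact ⟨e.symm i, by simpa using hi⟩
  · have : {k | y ∈ U (e k)}.ncard = {i | y ∈ U i}.ncard :=
      Set.ncard_preimage_of_injective_subset_range (s := {i | y ∈ U i}) e.injective
        (by simp [e.surjective.range_eq])
    rw [this]
    exact hB y

end Nerve

/-! ### Covers by sublevel and superlevel sets -/

section Threshold

variable {X C : Type*}

/-- The set cut out by a sign pattern `p`: for each `c` the value `h c x` lies below the threshold
`ξ c` if `p c = -1`, above it if `p c = 1`, and within `η` of it if `p c = 0`. Moreover, `h c x` is
closer to its threshold for the `c` with `p c = 0` than for all others. This makes the zero sets of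
the patterns of the sets containing a given point a chain. -/
def thresholdSet (h : C → X → ℝ) (ξ : C → ℝ) (η : ℝ) (p : C → SignType) : Set X :=
  {x | (∀ c, p c = -1 → h c x < ξ c) ∧ (∀ c, p c = 1 → ξ c < h c x) ∧
    (∀ c, p c = 0 → |h c x - ξ c| < η) ∧
    ∀ c c', p c = 0 → p c' ≠ 0 → |h c x - ξ c| < |h c' x - ξ c'|}

variable {h : C → X → ℝ} {ξ : C → ℝ} {η : ℝ}

lemma isOpen_thresholdSet [Finite C] [TopologicalSpace X] (hh : ∀ c, Continuous (h c))
    (p : C → SignType) : IsOpen (thresholdSet h ξ η p) := by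
  have habs : ∀ c, Continuous fun x => |h c x - ξ c| := fun c => ((hh c).sub continuous_const).abs
  simp only [thresholdSet, ofPred_and, ofPred_forall]
  refine (isOpen_iInter_of_finite fun c => isOpen_iInter_of_finite fun _ =>
    isOpen_lt (hh c) continuous_const).inter <|
    (isOpen_iInter_of_finite fun c => isOpen_iInter_of_finite fun _ =>
      isOpen_lt continuous_const (hh c)).inter <|
    (isOpen_iInter_of_finite fun c => isOpen_iInter_of_finite fun _ =>
      isOpen_lt (habs c) continuous_const).inter <|
    isOpen_iInter_of_finite fun c => isOpen_iInter_of_finite fun c' =>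
      isOpen_iInter_of_finite fun _ => isOpen_iInter_of_finite fun _ => isOpen_lt (habs c) (habs c')

lemma exists_mem_thresholdSet (hη : 0 < η) (x : X) : ∃ p, x ∈ thresholdSet h ξ η p := by
  refine ⟨fun c => SignType.sign (h c x - ξ c), fun c hc => ?_, fun c hc => ?_, fun c hc => ?_,
    fun c c' hc hc' => ?_⟩
  · exact sub_neg.1 (sign_eq_neg_one_iff.1 hc)
  · exact sub_pos.1 (sign_eq_one_iff.1 hc)
  · rwa [sign_eq_zero_iff.1 hc, abs_zero]
  · rw [sign_eq_zero_iff.1 hc, abs_zero]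
    exact abs_pos.2 (sign_ne_zero.1 hc')

lemma ncard_setOf_mem_thresholdSet_le [Fintype C] (x : X) :
    {p | x ∈ thresholdSet h ξ η p}.ncard ≤ {c | |h c x - ξ c| < η}.ncard + 1 := by
  -- The zero sets form a chain, so that a pattern is determined by the size of its zero set.
  have hmaps : ∀ p ∈ {p | x ∈ thresholdSet h ξ η p}, {c | p c = 0}.ncard ∈
      (Finset.range ({c | |h c x - ξ c| < η}.ncard + 1) : Set ℕ) := fun p hp => by
    have hle : {c | p c = 0}.ncard ≤ {c | |h c x - ξ c| < η}.ncard :=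
      Set.ncard_le_ncard fun c hc => hp.2.2.1 c hc
    simpa [Nat.lt_succ_iff] using hle
  have hinj : Set.InjOn (fun p : C → SignType => {c | p c = 0}.ncard)
      {p | x ∈ thresholdSet h ξ η p} := fun p hp q hq hpq => by
    have hzero : {c | p c = 0} = {c | q c = 0} := by
      by_cases hsub : {c | p c = 0} ⊆ {c | q c = 0}
      · exact Set.eq_of_subset_of_ncard_le hsub hpq.symm.le
      · obtain ⟨c, hc, hc'⟩ := Set.not_subset.1 hsub
        refine (Set.eq_of_subset_of_ncard_le (fun c' hq0 => ?_) hpq.le).symm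
        by_contra hp0
        exact lt_asymm (hp.2.2.2 c c' hc hp0) (hq.2.2.2 c' c hq0 hc')
    funext c
    have hz : p c = 0 ↔ q c = 0 := Set.ext_iff.1 hzero c
    have hp1 := hp.1 c
    have hp2 := hp.2.1 c
    have hq1 := hq.1 c
    have hq2 := hq.2.1 c
    rcases SignType.trichotomy (p c) with h1 | h1 | h1 <;>
      rcases SignType.trichotomy (q c) with h2 | h2 | h2 <;>
      simp only [h1, h2] at hz hp1 hp2 hq1 hq2 ⊢ <;> simp at hz hp1 hp2 hq1 hq2 <;> linarith
  have := Set.ncard_le_ncard_of_injOn _ hmaps hinj (Finset.finite_toSet _)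
  rwa [Set.ncard_coe_finset, Finset.card_range] at this

/-- Averaging over thresholds: each coordinate `c` chooses one of `M` values `θ k`, and for every
`i` at most one of these is near `t i c`. On average over the choices, `β` to the number of near
coordinates is then at most `(1 + β / M) ^ card C`. -/
lemma exists_sum_pow_card_near_le {I : Type*} [Fintype I] [Fintype C] {M : ℕ} (hM : 0 < M)
    (near : I → C → Fin M → Prop) (hnear : ∀ i c k l, near i c k → near i c l → k = l)
    {w : I → ℝ} (hw : ∀ i, 0 ≤ w i) {β : ℝ} (hβ : 0 ≤ β) :
    ∃ ξ : C → Fin M, ∑ i, w i * β ^ {c | near i c (ξ c)}.ncard ≤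
      (1 + β / M) ^ Fintype.card C * ∑ i, w i := by
  classical
  have hM' : (0 : ℝ) < M := by exact_mod_cast hM
  have hone : ∀ i c, ∑ k, (if near i c k then β else 1) ≤ M + β := fun i c => by
    by_cases hex : ∃ k, near i c k
    · obtain ⟨k, hk⟩ := hex
      rw [← Finset.add_sum_erase _ _ (Finset.mem_univ k), if_pos hk]
      have : ∑ l ∈ Finset.univ.erase k, (if near i c l then β else 1) ≤ (M : ℝ) := by
        rw [Finset.sum_congr rfl fun l hl => if_neg fun hl' =>
          (Finset.mem_erase.1 hl).1 (hnear i c l k hl' hk)]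
        simp [Finset.card_erase_of_mem]
      linarith
    · push Not at hex
      simp [hex, hβ]
  have hpow : ∀ i (ξ : C → Fin M),
      β ^ {c | near i c (ξ c)}.ncard = ∏ c, if near i c (ξ c) then β else 1 := fun i ξ => by
    rw [Finset.prod_ite, Finset.prod_const, Finset.prod_const_one, mul_one,
      ← Set.ncard_coe_finset]
    simp
  have havg : ∑ ξ : C → Fin M, ∑ i, w i * β ^ {c | near i c (ξ c)}.ncard ≤
      ∑ _ξ : C → Fin M, (1 + β / M) ^ Fintype.card C * ∑ i, w i := by
    rw [Finset.sum_comm, Finset.sum_const, Finset.card_univ, Fintype.card_fun, Fintype.card_fin,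
      nsmul_eq_mul, Nat.cast_pow, ← mul_assoc, ← mul_pow, mul_add, mul_one,
      mul_div_cancel₀ _ hM'.ne', Finset.mul_sum]
    refine Finset.sum_le_sum fun i _ => ?_
    rw [← Finset.mul_sum, mul_comm]
    refine mul_le_mul_of_nonneg_right ?_ (hw i)
    simp only [hpow]
    rw [← Fintype.prod_sum (fun c k => if near i c k then β else (1 : ℝ)), ← Finset.card_univ,
      ← Finset.prod_const]
    exact Finset.prod_le_prod
      (fun c _ => Finset.sum_nonneg fun k _ => by split_ifs <;> positivity) fun c _ => hone i c
  have : Nonempty (C → Fin M) := ⟨fun _ => ⟨0, hM⟩⟩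
  obtain ⟨ξ, -, hξ⟩ := Finset.exists_le_of_sum_le Finset.univ_nonempty havg
  exact ⟨ξ, hξ⟩

end Threshold

/-! ### Mean dimension is at most the lower metric mean dimension -/

section MeanDim

variable {X : Type*} [MetricSpace X] [CompactSpace X] [Nonempty X] {T : X → X} {f : X → ℝ}

/-- The width dimension at a fixed scale `ε` against the covering sum at a much smaller scale `δ`.
The complex is the nerve of the cover by threshold sets of the functions `x ↦ d (T^j x) e`, for
`j < n` and `e` in a net `N`. The thresholds lie between `ε / 8` and `ε / 4`, with spacing `4 * δ`,
and are chosen by averaging against the weights of a nearly optimal cover at scale `δ`. -/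
lemma widim_le_logCoverSum (hT : Continuous T) (hf : Continuous f) {ε δ ω : ℝ} (hδ : 0 < δ)
    (hδ1 : δ < 1) (hδε : 64 * δ ≤ ε) (hω : ∀ u v, dist u v < ε → |f u - f v| ≤ ω) {N : Finset X}
    (hN : ∀ x, ∃ e ∈ N, dist x e < ε / 8) (n : ℕ) :
    widim T f n ε ≤ (((n * (N.card * Real.log (1 + 64 / ε)) + logCoverSum T f δ n + 1) /
      Real.log (1 / δ) + n * ω : ℝ) : EReal) := by
  classical
  have hε : 0 < ε := by linarith
  have hl := log_one_div_pos hδ hδ1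
  obtain ⟨m, U, s, hU, hUs⟩ := exists_isWeightedCover hT hf hδ hδ1.le n one_pos
  have hpt : ∀ i, ∃ x, (U i).Nonempty → x ∈ U i := fun i => by
    rcases (U i).eq_empty_or_nonempty with h | ⟨x, hx⟩
    · exact ⟨Classical.arbitrary X, fun h' => absurd h h'.ne_empty⟩
    · exact ⟨x, fun _ => hx⟩
  choose a ha using hpt
  set M : ℕ := ⌊ε / (32 * δ)⌋₊ with hM
  have hMle : 4 * δ * M ≤ ε / 8 := by
    have := Nat.floor_le (show 0 ≤ ε / (32 * δ) by positivity)
    rw [← hM, le_div_iff₀ (by positivity)] at this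
    linarith
  have hMge : ε ≤ 64 * δ * M := by
    have := Nat.lt_floor_add_one (ε / (32 * δ))
    rw [← hM, div_lt_iff₀ (by positivity)] at this
    linarith
  have hM0 : (0 : ℝ) < M := by
    by_contra! h
    nlinarith
  let θ : Fin M → ℝ := fun k => ε / 8 + 4 * δ * k
  have hθ1 : ∀ k, ε / 8 ≤ θ k := fun k => le_add_of_nonneg_right (by positivity)
  have hθ2 : ∀ k, θ k ≤ ε / 4 := fun k => by
    have hk : ((k : ℕ) : ℝ) ≤ M := by exact_mod_cast k.2.le
    have := mul_le_mul_of_nonneg_left hk (show 0 ≤ 4 * δ by positivity)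
    simp only [θ]
    linarith
  let h : Fin n × N → X → ℝ := fun c x => dist (T^[c.1] x) c.2
  have hh : ∀ c, Continuous (h c) := fun c => (hT.iterate c.1).dist continuous_const
  obtain ⟨ξ, hξ⟩ := exists_sum_pow_card_near_le (I := Fin m) (C := Fin n × N) (M := M)
    (by exact_mod_cast hM0) (fun i c k => |h c (a i) - θ k| < 2 * δ)
    (fun i c k l hk hl => by
      -- Two thresholds near the same value are less than `4 * δ` apart.
      have h1 := abs_lt.1 hk
      have h2 := abs_lt.1 hl
      have h3 : (k : ℝ) < l + 1 := by
        refine lt_of_mul_lt_mul_left (a := 4 * δ) ?_ (by positivity)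
        simp only [θ] at h1 h2
        linarith
      have h4 : (l : ℝ) < k + 1 := by
        refine lt_of_mul_lt_mul_left (a := 4 * δ) ?_ (by positivity)
        simp only [θ] at h1 h2
        linarith
      have h3' : (k : ℕ) < l + 1 := by exact_mod_cast h3
      have h4' : (l : ℕ) < k + 1 := by exact_mod_cast h4
      exact Fin.ext (by omega))
    (w := fun i => (1 / δ) ^ s i) (fun i => by positivity) (β := 1 / δ) (by positivity)
  have hβM : 1 + 1 / δ / M ≤ 1 + 64 / ε := by
    rw [add_le_add_iff_left, div_div, div_le_div_iff₀ (by positivity) hε]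
    linarith
  have hcard : Fintype.card (Fin n × N) = n * N.card := by simp
  have hkey : ∀ i, ({c | |h c (a i) - θ (ξ c)| < 2 * δ}.ncard : ℝ) + s i ≤
      (n * (N.card * Real.log (1 + 64 / ε)) + logCoverSum T f δ n + 1) / Real.log (1 / δ) := by
    intro i
    have h1 : (1 / δ) ^ s i * (1 / δ) ^ {c | |h c (a i) - θ (ξ c)| < 2 * δ}.ncard ≤
        (1 + 64 / ε) ^ (n * N.card) * Real.exp (logCoverSum T f δ n + 1) := by
      refine (Finset.single_le_sum (f := fun i => (1 / δ) ^ s i *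
        (1 / δ) ^ {c | |h c (a i) - θ (ξ c)| < 2 * δ}.ncard) (fun i _ => by positivity)
        (Finset.mem_univ i)).trans (hξ.trans ?_)
      rw [hcard]
      exact mul_le_mul (pow_le_pow_left₀ (by positivity) hβM _) hUs.le
        (Finset.sum_nonneg fun i _ => by positivity) (by positivity)
    have h2 := Real.log_le_log (by positivity) h1
    rw [Real.log_mul (by positivity) (by positivity), Real.log_mul (by positivity) (by positivity),
      Real.log_rpow (by positivity), Real.log_pow, Real.log_pow, Real.log_exp, Nat.cast_mul] at h2
    rw [le_div_iff₀ hl]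
    linarith
  -- Each coordinate `(j, e)` with `T^j x` close to `e` confines `T^j` of the whole member.
  have hclose : ∀ p, ∀ x ∈ thresholdSet h (fun c => θ (ξ c)) δ p,
      ∀ y ∈ thresholdSet h (fun c => θ (ξ c)) δ p, ∀ j < n,
      dist (T^[j] x) (T^[j] y) ≤ ε / 8 + (ε / 4 + δ) := by
    intro p x hx y hy j hj
    obtain ⟨e, heN, he⟩ := hN (T^[j] x)
    let c : Fin n × N := (⟨j, hj⟩, ⟨e, heN⟩)
    have hxc : h c x < ε / 8 := he
    have hyc : h c y ≤ ε / 4 + δ := by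
      have h2 := hθ2 (ξ c)
      rcases SignType.trichotomy (p c) with h1 | h1 | h1
      · have := hy.1 c h1
        simp only at this
        linarith
      · have := (abs_lt.1 (hy.2.2.1 c h1)).2
        linarith
      · have := hx.2.1 c h1
        simp only at this
        linarith [hθ1 (ξ c)]
    exact (dist_triangle_right _ _ e).trans (add_le_add hxc.le hyc)
  refine widim_le_of_openCover hε (isOpen_thresholdSet (ξ := fun c => θ (ξ c)) (η := δ) hh)
    (exists_mem_thresholdSet hδ) (fun p => bowenDiam_lt hε (by linarith) (hclose p))
    (fun p x hx y hy => birkhoffSum_le_add_of_dist_lt hω fun j hj =>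
      (hclose p x hx y hy j hj).trans_lt (by linarith)) fun y => ?_
  obtain ⟨i, hi⟩ := hU.exists_mem y
  have hsub : {c | |h c y - θ (ξ c)| < δ} ⊆ {c | |h c (a i) - θ (ξ c)| < 2 * δ} := fun c hc => by
    have h1 : |h c (a i) - h c y| < δ := (abs_dist_sub_le _ _ _).trans_lt <|
      (dist_iterate_le_bowenDiam (ha i ⟨y, hi⟩) hi c.1.2).trans_lt (hU.diam_lt i)
    have h2 := abs_sub_le (h c (a i)) (h c y) (θ (ξ c))
    have h3 : |h c y - θ (ξ c)| < δ := hc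
    show |h c (a i) - θ (ξ c)| < 2 * δ
    linarith
  have hle := (ncard_setOf_mem_thresholdSet_le (h := h) (ξ := fun c => θ (ξ c)) (η := δ) y).trans
    (Nat.add_le_add_right (Set.ncard_le_ncard hsub) 1)
  have hle' : ({p | y ∈ thresholdSet h (fun c => θ (ξ c)) δ p}.ncard : ℝ) ≤
      {c | |h c (a i) - θ (ξ c)| < 2 * δ}.ncard + 1 := by exact_mod_cast hle
  linarith [hkey i, hU.sum_le i y hi]

/-- The growth rate of the width dimension at scale `ε`; the error term is the oscillation of `f`
at scale `ε`. -/
lemma limsup_widim_div_le (hT : Continuous T) (hf : Continuous f) {ε ω τ z : ℝ} (hε : 0 < ε)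
    (hω : ∀ u v, dist u v < ε → |f u - f v| ≤ ω) (hτ : 0 < τ)
    (hz : lowerMetricMeanDim T f < z) :
    limsup (fun n : ℕ => widim T f n ε / (n : EReal)) atTop ≤ ((z + τ + ω : ℝ) : EReal) := by
  obtain ⟨N, -, hN⟩ := exists_finset_separated (continuous_id (X := X)) (ε := ε / 8)
    (by positivity)
  have hev : ∀ᶠ δ : ℝ in 𝓝[>] 0, (0 < δ ∧ δ < min 1 (ε / 64)) ∧
      N.card * Real.log (1 + 64 / ε) / τ ≤ Real.log (1 / δ) :=
    (eventually_mem_Ioo (by positivity)).and (tendsto_log_one_div.eventually_ge_atTop _)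
  obtain ⟨δ, hδz, ⟨hδ, hδ1⟩, hA⟩ :=
    ((frequently_lt_of_liminf_lt (by isBoundedDefault) hz).and_eventually hev).exists
  rw [lt_min_iff] at hδ1
  have hl := log_one_div_pos hδ hδ1.1
  obtain ⟨r, hr, h⟩ := exists_tendsto_logCoverSum hT hf hδ hδ1.1.le
  rw [h, ← EReal.coe_div, EReal.coe_lt_coe_iff] at hδz
  set A := N.card * Real.log (1 + 64 / ε)
  have hlim : Tendsto (fun n : ℕ => (((n * A + logCoverSum T f δ n + 1) /
      Real.log (1 / δ) + n * ω) / n : ℝ)) atTop (𝓝 ((A + r + 0) / Real.log (1 / δ) + ω)) := by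
    refine ((((tendsto_const_nhds.add hr).add tendsto_one_div_atTop_nhds_zero_nat).div_const
      (Real.log (1 / δ))).add_const ω).congr' ?_
    filter_upwards [eventually_gt_atTop 0] with n hn
    have hn' : (n : ℝ) ≠ 0 := by exact_mod_cast hn.ne'
    field_simp
  calc limsup (fun n : ℕ => widim T f n ε / (n : EReal)) atTop
      ≤ limsup (fun n : ℕ => ((((n * A + logCoverSum T f δ n + 1) /
          Real.log (1 / δ) + n * ω) / n : ℝ) : EReal)) atTop := by
        refine limsup_le_limsup (Eventually.of_forall fun n => ?_) (by isBoundedDefault)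
          (by isBoundedDefault)
        simp only
        rw [EReal.coe_div, EReal.coe_natCast]
        exact EReal.div_le_div_right_of_nonneg (by positivity)
          (widim_le_logCoverSum hT hf hδ hδ1.1 (by linarith) hω hN n)
    _ = (((A + r + 0) / Real.log (1 / δ) + ω : ℝ) : EReal) := (EReal.tendsto_coe.2 hlim).limsup_eq
    _ ≤ _ := by
        rw [EReal.coe_le_coe_iff, add_zero, add_div]
        have : A / Real.log (1 / δ) ≤ τ := by
          rw [div_le_iff₀ hl]
          rw [div_le_iff₀ hτ] at hA
          linarith
        linarith

theorem meanDim_le_lowerMetricMeanDim (hT : Continuous T) (hf : Continuous f) :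
    meanDim T f ≤ lowerMetricMeanDim T f := by
  refine EReal.le_of_forall_lt_iff_le.1 fun z hz => ?_
  obtain ⟨z', hz', hzz'⟩ := EReal.lt_iff_exists_real_btwn.1 hz
  rw [EReal.coe_lt_coe_iff] at hzz'
  have hg : 0 < z - z' := sub_pos.2 hzz'
  refine limsup_le_of_le (by isBoundedDefault) ?_
  filter_upwards [self_mem_nhdsWithin, eventually_abs_sub_le hf (half_pos hg)] with ε hε hω
  refine (limsup_widim_div_le hT hf hε hω (half_pos hg) hz').trans (le_of_eq ?_)
  congr 1
  ring

end MeanDim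

lemma lowerMetricMeanDim_eq_upperMetricMeanDim {X : Type*} [MetricSpace X] [CompactSpace X]
    {T : X → X} {f : X → ℝ} (hT : Continuous T) (hf : Continuous f)
    (h : meanDim T f = upperMetricMeanDim T f) :
    lowerMetricMeanDim T f = upperMetricMeanDim T f := by
  rcases isEmpty_or_nonempty X with hX | hX
  · rw [upperMetricMeanDim_of_isEmpty, lowerMetricMeanDim_of_isEmpty]
  · exact (lowerMetricMeanDim_le_upperMetricMeanDim T f).antisymm
      (h ▸ meanDim_le_lowerMetricMeanDim hT hf)

end MeanDimPotential

end

/-- The product `X₁ × X₂` carries Mathlib's product metric, which is the max metric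
`d ((x₁, x₂), (y₁, y₂)) = max (d₁ x₁ y₁) (d₂ x₂ y₂)`. -/
theorem proposition2p4 {X₁ X₂ : Type*} [MetricSpace X₁] [CompactSpace X₁]
    [MetricSpace X₂] [CompactSpace X₂]
    (T₁ : X₁ → X₁) (hT₁ : Continuous T₁) (T₂ : X₂ → X₂) (hT₂ : Continuous T₂)
    (f₁ : X₁ → ℝ) (hf₁ : Continuous f₁) (f₂ : X₂ → ℝ) (hf₂ : Continuous f₂) :
    MeanDimPotential.upperMetricMeanDim (Prod.map T₁ T₂)
        (fun p : X₁ × X₂ => f₁ p.1 + f₂ p.2) ≤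
      MeanDimPotential.upperMetricMeanDim T₁ f₁ + MeanDimPotential.upperMetricMeanDim T₂ f₂ ∧
    MeanDimPotential.lowerMetricMeanDim T₁ f₁ + MeanDimPotential.lowerMetricMeanDim T₂ f₂ ≤
      MeanDimPotential.lowerMetricMeanDim (Prod.map T₁ T₂)
        (fun p : X₁ × X₂ => f₁ p.1 + f₂ p.2) ∧
    (MeanDimPotential.HasMarkerProperty T₁ → MeanDimPotential.HasMarkerProperty T₂ →
      MeanDimPotential.meanDim T₁ f₁ = MeanDimPotential.upperMetricMeanDim T₁ f₁ →
      MeanDimPotential.meanDim T₂ f₂ = MeanDimPotential.upperMetricMeanDim T₂ f₂ →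
      MeanDimPotential.lowerMetricMeanDim T₁ f₁ = MeanDimPotential.upperMetricMeanDim T₁ f₁ ∧
      MeanDimPotential.lowerMetricMeanDim T₂ f₂ = MeanDimPotential.upperMetricMeanDim T₂ f₂ ∧
      MeanDimPotential.lowerMetricMeanDim (Prod.map T₁ T₂)
          (fun p : X₁ × X₂ => f₁ p.1 + f₂ p.2) =
        MeanDimPotential.upperMetricMeanDim (Prod.map T₁ T₂)
          (fun p : X₁ × X₂ => f₁ p.1 + f₂ p.2) ∧
      MeanDimPotential.upperMetricMeanDim (Prod.map T₁ T₂)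
          (fun p : X₁ × X₂ => f₁ p.1 + f₂ p.2) =
        MeanDimPotential.upperMetricMeanDim T₁ f₁ +
          MeanDimPotential.upperMetricMeanDim T₂ f₂) := by
  have hupper : MeanDimPotential.upperMetricMeanDim (Prod.map T₁ T₂)
      (fun p : X₁ × X₂ => f₁ p.1 + f₂ p.2) ≤
      MeanDimPotential.upperMetricMeanDim T₁ f₁ + MeanDimPotential.upperMetricMeanDim T₂ f₂ := by
    rcases isEmpty_or_nonempty X₁ with h₁ | h₁
    · simp [MeanDimPotential.upperMetricMeanDim_of_isEmpty]
    rcases isEmpty_or_nonempty X₂ with h₂ | h₂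
    · simp [MeanDimPotential.upperMetricMeanDim_of_isEmpty]
    exact MeanDimPotential.upperMetricMeanDim_prodMap_le hT₁ hT₂ hf₁ hf₂
  have hlower : MeanDimPotential.lowerMetricMeanDim T₁ f₁ +
      MeanDimPotential.lowerMetricMeanDim T₂ f₂ ≤
      MeanDimPotential.lowerMetricMeanDim (Prod.map T₁ T₂)
        (fun p : X₁ × X₂ => f₁ p.1 + f₂ p.2) := by
    rcases isEmpty_or_nonempty X₁ with h₁ | h₁
    · simp [MeanDimPotential.lowerMetricMeanDim_of_isEmpty]
    rcases isEmpty_or_nonempty X₂ with h₂ | h₂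
    · simp [MeanDimPotential.lowerMetricMeanDim_of_isEmpty]
    exact MeanDimPotential.lowerMetricMeanDim_add_le_prodMap hT₁ hT₂ hf₁ hf₂
  refine ⟨hupper, hlower, fun _ _ h₁ h₂ => ?_⟩
  have e₁ := MeanDimPotential.lowerMetricMeanDim_eq_upperMetricMeanDim hT₁ hf₁ h₁
  have e₂ := MeanDimPotential.lowerMetricMeanDim_eq_upperMetricMeanDim hT₂ hf₂ h₂
  have hle := MeanDimPotential.lowerMetricMeanDim_le_upperMetricMeanDim (Prod.map T₁ T₂)
    (fun p : X₁ × X₂ => f₁ p.1 + f₂ p.2)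
  rw [e₁, e₂] at hlower
  exact ⟨e₁, e₂, hle.antisymm (hupper.trans hlower), hupper.antisymm (hlower.trans hle)⟩
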